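/- All graphs are finite, simple and undirected. In the game of cops and robber on a graph $G$, $k$ cops choose initial vertices (several cops may share a vertex), then the robber, who sees them, chooses an initial vertex. In each round, every cop stays or moves to a neighboring vertex, and then the robber stays or moves to a neighboring vertex; all positions are visible to both sides. The robber is captured as soon as some cop occupies the robber's vertex. Let $\operatorname{capt}_k(G)\in\{0,1,2,\dots\}\cup\{\infty\}$ be the number of rounds until capture under optimal play with $k$ cops (the initial placement is round $0$, and the value is $\infty$ if $k$ cops cannot force a capture), and let $\operatorname{th}_c(G)=\min_{k\ge 1}\bigl(k+\operatorname{capt}_k(G)\bigr)$. **Corollary.** Let $k:\mathbb N\to\mathbb N$ satisfy $k(n)=o(\sqrt n)$ as $n\to\infty$. Then there is a function $\delta:\mathbb N\to\mathbb R$ with $\delta(n)\to 0$ such that every connected graph $G$ of order $n$ with at most $k(n)$ cycles (counted as subgraphs) satisfies $$\operatorname{th}_c(G)\le\Bigl(\frac{\sqrt{14}}{2}+\delta(n)\Bigr)\sqrt n .$$ In particular, there is a function $\delta:\mathbb N\to\mathbb R$ with $\delta(n)\to0$ such that this inequality holds for every connected unicyclic graph $G$ of order $n$, that is, every connected graph with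 exactly one cycle. -/

import Mathlib

namespace CopsRobber

/-- A (deterministic) strategy of `k` cops on `G`. The argument of `pos` is the list of the positions
that the robber has occupied so far, latest first: `pos []` is the initial placement of the cops,
and `pos (r :: h)` is the placement to which the cops move when they last stood at `pos h` and the
robber, with earlier positions `h`, now stands at `r`. Each cop stays or moves along an edge;
several cops may occupy the same vertex. -/
structure CopStrategy {V : Type*} (G : SimpleGraph V) (k : ℕ) where
  pos : List V → Fin k → V
  legal : ∀ (h : List V) (r : V) (i : Fin k),
    pos (r :: h) i = pos h i ∨ G.Adj (pos h i) (pos (r :: h) i)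

/-- The sequence of moves of a robber on `G`: `pos 0` is the initial position and `pos t` the position
at the end of round `t`. In each round the robber stays or moves along an edge. -/
structure RobberPlay {V : Type*} (G : SimpleGraph V) where
  pos : ℕ → V
  legal : ∀ t : ℕ, pos (t + 1) = pos t ∨ G.Adj (pos t) (pos (t + 1))

/-- The positions of the robber before round `t` is played, that is, the list
`[ρ (t - 1), …, ρ 1, ρ 0]`; round `0` is the initial placement. -/
def history {V : Type*} (ρ : ℕ → V) : ℕ → List V
  | 0 => []
  | t + 1 => ρ t :: history ρ t

/-- Some cop and the robber occupy the same vertex in round `t`: after the initial placement if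
`t = 0`, and otherwise after the cops' move or after the robber's move of round `t`. -/
def CapturedInRound {V : Type*} {G : SimpleGraph V} {k : ℕ}
    (σ : CopStrategy G k) (ρ : RobberPlay G) : ℕ → Prop
  | 0 => ∃ i : Fin k, σ.pos [] i = ρ.pos 0
  | t + 1 => ∃ i : Fin k, σ.pos (history ρ.pos (t + 1)) i = ρ.pos t ∨
      σ.pos (history ρ.pos (t + 1)) i = ρ.pos (t + 1)

/-- The first round in which the robber is captured (`⊤` if this never happens). -/
noncomputable def captureRound {V : Type*} {G : SimpleGraph V} {k : ℕ}
    (σ : CopStrategy G k) (ρ : RobberPlay G) : ℕ∞ :=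
  ⨅ (t : ℕ) (_ : CapturedInRound σ ρ t), (t : ℕ∞)

/-- The `k`-capture time of `G`: the number of rounds in which `k` cops capture the robber if both
sides play optimally (`⊤` if `k` cops cannot force a capture). Since the cops' strategy is
deterministic, a robber's strategy against it amounts to a sequence of moves. -/
noncomputable def captureTime {V : Type*} (G : SimpleGraph V) (k : ℕ) : ℕ∞ :=
  ⨅ σ : CopStrategy G k, ⨆ ρ : RobberPlay G, captureRound σ ρ

/-- The cop throttling number: the minimum over positive integers `k` of `k` plus the
`k`-capture time. -/
noncomputable def throttlingNumber {V : Type*} (G : SimpleGraph V) : ℕ∞ :=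
  ⨅ (k : ℕ) (_ : 1 ≤ k), ((k : ℕ∞) + captureTime G k)

/-- The number of cycles of `G`, counted as subgraphs. -/
noncomputable def numCycles {V : Type*} (G : SimpleGraph V) : ℕ∞ :=
  {H : G.Subgraph | ∃ (v : V) (p : G.Walk v v), p.IsCycle ∧ p.toSubgraph = H}.encard

end CopsRobber

namespace CopsRobber

open Finset Asymptotics

variable {V : Type*} {G T : SimpleGraph V}

/-! ### Geodesics -/

/-! Fix a spanning tree `T`. The fundamental cycles of the edges outside `T` are distinct, so there
are at most `k(n)` such edges, and one immobile cop at an end of each confines the robber to `T`. If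
balls of radius `r` about `D` cover `T`, cops who start on `D` and chase along `T` win within `r`
rounds, so th_c is at most `k(n) + #D + r`.

In a tree some cover by `r`-balls is no larger than some packing of `r`-balls
(`exists_cover_packing`). Packings of radii `4m` and `3m`, the first with at least two centers, have
at most `n/(2m)` centers together (`card_add_card_le_of_packings`). With `m` about `√(14n)/14`, one
of the two radii therefore gives `#D + r ≤ (√14/2)√n + 5`; the excess `k(n) + 5` is `o(√n)`. -/

lemma exists_adj_dist_succ (hG : G.Connected) {x y : V} (h : x ≠ y) :
    ∃ z, G.Adj x z ∧ G.dist z y + 1 = G.dist x y := by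
  obtain ⟨p, hp⟩ := hG.exists_walk_length_eq_dist x y
  cases p with
  | nil => exact absurd rfl h
  | @cons _ z _ hz q =>
    refine ⟨z, hz, ?_⟩
    have h1 : G.dist z y ≤ q.length := SimpleGraph.dist_le q
    have h2 : G.dist x y ≤ G.dist x z + G.dist z y := hG.dist_triangle
    rw [SimpleGraph.dist_eq_one_iff_adj.mpr hz] at h2
    rw [SimpleGraph.Walk.length_cons] at hp
    omega

lemma exists_dist_eq_add (hG : G.Connected) (u c : V) (r : ℕ) (hr : r ≤ G.dist u c) :
    ∃ d, G.dist u d = r ∧ r + G.dist d c = G.dist u c := by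
  induction r with
  | zero => exact ⟨u, by simp⟩
  | succ r ih =>
    obtain ⟨d, h1, h2⟩ := ih (by omega)
    have hne : d ≠ c := by
      rintro rfl
      rw [SimpleGraph.dist_self] at h2
      omega
    obtain ⟨z, hz, h3⟩ := exists_adj_dist_succ hG hne
    have h4 : G.dist u z ≤ G.dist u d + G.dist d z := hG.dist_triangle
    have h5 : G.dist u c ≤ G.dist u z + G.dist z c := hG.dist_triangle
    rw [SimpleGraph.dist_eq_one_iff_adj.mpr hz] at h4
    exact ⟨z, by omega, by omega⟩

lemma dist_le_succ_of_adj (hG : G.Connected) (c : V) {v w : V} (h : G.Adj v w) :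
    G.dist c w ≤ G.dist c v + 1 := by
  have := hG.dist_triangle (u := c) (v := v) (w := w)
  rwa [SimpleGraph.dist_eq_one_iff_adj.mpr h] at this

/-! ### Distances in trees -/

/-- Geodesics from `c` to `a` and to `b` extend to two paths from `c` to `v`, which coincide in a
tree. -/
lemma eq_of_adj_of_dist_lt (hT : T.IsTree) {c v a b : V} (ha : T.Adj a v) (hb : T.Adj b v)
    (hac : T.dist c a + 1 = T.dist c v) (hbc : T.dist c b + 1 = T.dist c v) : a = b := by
  obtain ⟨p, hp⟩ := hT.connected.exists_walk_length_eq_dist c a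
  obtain ⟨q, hq⟩ := hT.connected.exists_walk_length_eq_dist c b
  have hp' := (p.concat ha).isPath_of_length_eq_dist (by simp [hp, hac])
  have hq' := (q.concat hb).isPath_of_length_eq_dist (by simp [hq, hbc])
  have := congrArg SimpleGraph.Walk.penultimate (hT.existsUnique_path c v |>.unique hp' hq')
  simpa using this

/-- In a tree, a vertex `z` between `c` and `y` remains between `c` and a neighbor of `y`, unless
`y = z`. -/
lemma between_of_adj (hT : T.IsTree) {c z y y' : V} (h : T.dist c z + T.dist z y = T.dist c y)
    (hy : y ≠ z) (hadj : T.Adj y y') : T.dist c z + T.dist z y' = T.dist c y' := by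
  have hG := hT.connected
  have h1 := dist_le_succ_of_adj hG z hadj
  have h2 : T.dist c y' ≤ T.dist c z + T.dist z y' := hG.dist_triangle
  rcases hT.dist_eq_dist_add_one_of_adj c hadj with h3 | h3
  · obtain ⟨w, hw, h4⟩ := exists_adj_dist_succ hG hy
    rw [SimpleGraph.dist_comm (u := w), SimpleGraph.dist_comm (u := y)] at h4
    have h5 : T.dist c w ≤ T.dist c z + T.dist z w := hG.dist_triangle
    have h6 := dist_le_succ_of_adj hG c hw.symm
    have : w = y' := eq_of_adj_of_dist_lt hT hw.symm hadj.symm (c := c) (by omega) (by omega)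
    subst this
    omega
  · omega

lemma between_or_between (hT : T.IsTree) {c z y : V} (h : T.dist c z + T.dist z y = T.dist c y)
    {x : V} (p : T.Walk y x) :
    T.dist c z + T.dist z x = T.dist c x ∨ z ∈ p.support := by
  induction p with
  | nil => exact .inl h
  | @cons a b x hab q ih =>
    by_cases hz : a = z
    · right; simp [hz]
    · rcases ih (between_of_adj hT h hz hab) with h | h
      · exact .inl h
      · right; simp [h]

lemma dist_add_of_not_between (hT : T.IsTree) {c z y x : V}
    (h : T.dist c z + T.dist z y = T.dist c y) (hx : T.dist c z + T.dist z x ≠ T.dist c x) :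
    T.dist y z + T.dist z x = T.dist y x := by
  classical
  obtain ⟨p, hp⟩ := hT.connected.exists_walk_length_eq_dist y x
  have hz := (between_or_between hT h p).resolve_left hx
  have h1 := SimpleGraph.dist_le (p.takeUntil z hz)
  have h2 := SimpleGraph.dist_le (p.dropUntil z hz)
  have h3 := congrArg SimpleGraph.Walk.length (p.take_spec hz)
  rw [SimpleGraph.Walk.length_append] at h3
  have h4 : T.dist y x ≤ T.dist y z + T.dist z x := hT.connected.dist_triangle
  omega

/-! ### Covering a tree by balls -/

/-- Greedy choice with `T` rooted at `c`: take `u` in `U` farthest from `c`, and let `d` be its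
ancestor `r` steps up (or `c`). By maximality of `u`, vertices of `U` behind `d` are within `r` of
`d`. Any other uncovered `x` is reached from `u` through `d`, hence is farther than `2r` from `u`.
Recurse on the uncovered vertices. -/
lemma exists_cover_packing_of_finset (hT : T.IsTree) (c : V) (r : ℕ) (U : Finset V) :
    ∃ D P : Finset V, P ⊆ U ∧ #D ≤ #P ∧ (∀ v ∈ U, ∃ d ∈ D, T.dist d v ≤ r) ∧
      ∀ x ∈ P, ∀ y ∈ P, x ≠ y → 2 * r < T.dist x y := by
  classical
  induction U using Finset.strongInduction with
  | H U ih =>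
    rcases U.eq_empty_or_nonempty with rfl | hU
    · exact ⟨∅, ∅, by simp⟩
    obtain ⟨u, hu, hmax⟩ := U.exists_max_image (fun v => T.dist c v) hU
    obtain ⟨d, hd1, hd2, hd3⟩ : ∃ d, T.dist d u ≤ r ∧ T.dist c d + T.dist d u = T.dist c u ∧
        (T.dist d u = r ∨ d = c) := by
      rcases le_total r (T.dist u c) with h | h
      · obtain ⟨d, h1, h2⟩ := exists_dist_eq_add hT.connected u c r h
        simp only [SimpleGraph.dist_comm (u := u), SimpleGraph.dist_comm (u := d) (v := c)] at *
        exact ⟨d, by omega, by omega, .inl h1⟩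
      · exact ⟨c, by rwa [SimpleGraph.dist_comm], by simp, .inr rfl⟩
    obtain ⟨D, P, hPU, hDP, hD, hP⟩ := ih (U.filter fun v => r < T.dist d v) (by
      refine ⟨filter_subset _ _, fun h => ?_⟩
      have := (mem_filter.mp (h hu)).2
      omega)
    have huP : u ∉ P := fun h => by
      have := (mem_filter.mp (hPU h)).2
      omega
    have key : ∀ x ∈ P, 2 * r < T.dist u x := by
      intro x hx
      obtain ⟨hxU, hxd⟩ := mem_filter.mp (hPU hx)
      have hle := hmax x hxU
      have hnot : T.dist c d + T.dist d x ≠ T.dist c x := by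
        rcases hd3 with h | rfl
        · omega
        · rw [SimpleGraph.dist_self] at *
          omega
      have h := dist_add_of_not_between hT hd2 hnot
      rcases hd3 with h' | rfl
      · rw [SimpleGraph.dist_comm] at h'
        omega
      · rw [SimpleGraph.dist_self] at hnot
        omega
    refine ⟨insert d D, insert u P, ?_, ?_, ?_, ?_⟩
    · exact insert_subset hu (hPU.trans (filter_subset _ _))
    · rw [card_insert_of_notMem huP]
      exact (card_insert_le _ _).trans (by omega)
    · intro v hv
      by_cases h : r < T.dist d v
      · obtain ⟨e, he, h'⟩ := hD v (mem_filter.mpr ⟨hv, h⟩)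
        exact ⟨e, mem_insert_of_mem he, h'⟩
      · exact ⟨d, mem_insert_self _ _, by omega⟩
    · intro x hx y hy hxy
      rcases mem_insert.mp hx with rfl | hxP <;> rcases mem_insert.mp hy with rfl | hyP
      · exact absurd rfl hxy
      · exact key y hyP
      · rw [SimpleGraph.dist_comm]
        exact key x hxP
      · exact hP x hxP y hyP hxy

/-- A tree has a covering by balls of radius `r` and a packing of balls of radius `r` such that the
former is at most as large as the latter. -/
lemma exists_cover_packing [Fintype V] (hT : T.IsTree) (r : ℕ) :
    ∃ D P : Finset V, #D ≤ #P ∧ (∀ v, ∃ d ∈ D, T.dist d v ≤ r) ∧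
      ∀ x ∈ P, ∀ y ∈ P, x ≠ y → 2 * r < T.dist x y := by
  obtain ⟨c⟩ := hT.connected.nonempty
  obtain ⟨D, P, -, h1, h2, h3⟩ := exists_cover_packing_of_finset hT c r univ
  exact ⟨D, P, h1, fun v => h2 v (mem_univ v), h3⟩

/-! ### Two packings at different scales -/

lemma exists_dist_eq_of_walk (hG : G.Connected) {A : Set V} {a b : A} (p : (G.induce A).Walk a b)
    (y : V) (j : ℕ) (ha : G.dist y a ≤ j) (hb : j ≤ G.dist y b) : ∃ w ∈ A, G.dist y w = j := by
  induction p with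
  | @nil a => exact ⟨a, a.2, by omega⟩
  | @cons a a' b h q ih =>
    by_cases hj : G.dist y a = j
    · exact ⟨a, a.2, hj⟩
    · have := dist_le_succ_of_adj hG y (SimpleGraph.induce_adj.mp h)
      exact ih (by omega) hb

/-- Along a walk inside `A` from `y` to `z` the distance from `y` changes by at most one per step,
so it takes every value `0, …, s`. -/
lemma lt_card_filter_dist_le (hG : G.Connected) (A : Finset V)
    (hA : (G.induce (A : Set V)).Preconnected) {y z : V} (hy : y ∈ A) (hz : z ∈ A) (s : ℕ)
    (h : s ≤ G.dist y z) : s < #(A.filter fun w => G.dist y w ≤ s) := by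
  classical
  have : range (s + 1) ⊆ (A.filter fun w => G.dist y w ≤ s).image (G.dist y) := by
    intro j hj
    rw [mem_range] at hj
    obtain ⟨p⟩ := hA ⟨y, hy⟩ ⟨z, hz⟩
    obtain ⟨w, hw, hwj⟩ := exists_dist_eq_of_walk hG p y j (by simp) (by simp; omega)
    exact mem_image.mpr ⟨w, mem_filter.mpr ⟨hw, by omega⟩, hwj⟩
  have h1 := card_le_card this
  rw [card_range] at h1
  exact h1.trans card_image_le

/-- The Voronoi cells of a finite set of vertices, with ties broken consistently. -/
lemma exists_voronoi [Fintype V] (hG : G.Connected) (P : Finset V) (hP : P.Nonempty) :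
    ∃ f : V → V, (∀ v, f v ∈ P) ∧ (∀ v, ∀ x ∈ P, G.dist v (f v) ≤ G.dist v x) ∧
      ∀ v w x, f v = x → G.Adj v w → G.dist w x + 1 = G.dist v x → f w = x := by
  classical
  let e := Fintype.equivFin V
  let N := Fintype.card V
  -- Lexicographic order: distance first, ties broken by the index `e x < N`.
  let key : V → V → ℕ := fun v x => G.dist v x * N + e x
  choose f hfP hf using fun v => P.exists_min_image (key v) hP
  have hlt : ∀ x, (e x : ℕ) < N := fun x => (e x).2
  refine ⟨f, hfP, fun v x hx => ?_, ?_⟩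
  · by_contra! h
    have h1 : G.dist v x * N + e x ≥ G.dist v (f v) * N + e (f v) := hf v x hx
    have h2 : (G.dist v x + 1) * N ≤ G.dist v (f v) * N := Nat.mul_le_mul_right N h
    have := hlt x
    rw [add_mul] at h2
    omega
  · rintro v w x rfl hvw hd
    have h1 : key w (f w) ≤ key w (f v) := hf w _ (hfP v)
    have h2 : key v (f v) ≤ key v (f w) := hf v _ (hfP w)
    have h3 : G.dist v (f w) ≤ G.dist w (f w) + 1 := by
      rw [SimpleGraph.dist_comm, SimpleGraph.dist_comm (u := w)]
      exact dist_le_succ_of_adj hG _ hvw.symm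
    have h4 := Nat.mul_le_mul_right N h3
    simp only [key, ← hd, add_mul] at h1 h2 h4
    have h5 : G.dist w (f w) * N + e (f w) = G.dist w (f v) * N + e (f v) := by omega
    have h6 := congrArg (· % N) h5
    simp only [Nat.mul_add_mod_self_right, Nat.mod_eq_of_lt (hlt _)] at h6
    exact e.injective (Fin.ext h6)

/-- Each Voronoi cell of `P` with `b` points of `Q` has at least `2m(1 + b)` vertices. For `b ≥ 2`,
disjoint `3m`-balls inside the connected cell give `3mb`; for `b ≤ 1`, the `4m`-ball about the site
gives `4m`. -/
lemma card_add_card_le_of_packings [Fintype V] (hG : G.Connected) (m : ℕ) (P Q : Finset V)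
    (hP : ∀ x ∈ P, ∀ y ∈ P, x ≠ y → 2 * (4 * m) < G.dist x y)
    (hQ : ∀ x ∈ Q, ∀ y ∈ Q, x ≠ y → 2 * (3 * m) < G.dist x y) (hP2 : 2 ≤ #P) :
    2 * m * (#P + #Q) ≤ Fintype.card V := by
  classical
  obtain ⟨f, hfP, hfmin, hf⟩ := exists_voronoi hG P (card_pos.mp (by omega))
  let A : V → Finset V := fun x => univ.filter fun v => f v = x
  let B : V → Finset V := fun x => Q.filter fun v => f v = x
  have hAcard : Fintype.card V = ∑ x ∈ P, #(A x) :=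
    card_eq_sum_card_fiberwise (fun v _ => hfP v)
  have hBcard : #Q = ∑ x ∈ P, #(B x) := card_eq_sum_card_fiberwise (fun v _ => hfP v)
  have hself : ∀ x ∈ P, f x = x := fun x hx => by
    have := hfmin x x hx
    rw [SimpleGraph.dist_self, Nat.le_zero, hG.dist_eq_zero_iff] at this
    exact this.symm
  have hconn : ∀ x ∈ P, (G.induce (A x : Set V)).Preconnected := by
    intro x hx
    have hxA : x ∈ (A x : Set V) := by simp [A, hself x hx]
    -- Consistent tie-breaking keeps a geodesic from `v` to its site inside the cell.
    have key : ∀ n v (hv : v ∈ (A x : Set V)), G.dist v x = n →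
        (G.induce (A x : Set V)).Reachable ⟨v, hv⟩ ⟨x, hxA⟩ := by
      intro n
      induction n with
      | zero =>
        intro v hv h
        obtain rfl := hG.dist_eq_zero_iff.mp h
        rfl
      | succ n ih =>
        intro v hv h
        have hne : v ≠ x := by
          rintro rfl
          simp at h
        obtain ⟨w, hw, hwd⟩ := exists_adj_dist_succ hG hne
        have hwA : w ∈ (A x : Set V) := by
          simpa [A] using hf v w x (by simpa [A] using hv) hw hwd
        have h1 : (G.induce (A x : Set V)).Adj ⟨v, hv⟩ ⟨w, hwA⟩ := hw
        exact h1.reachable.trans (ih w hwA (by omega))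
    exact fun a b => (key _ a a.2 rfl).trans (key _ b b.2 rfl).symm
  have hcell : ∀ x ∈ P, 2 * m * (1 + #(B x)) ≤ #(A x) := by
    intro x hx
    rcases Nat.lt_or_ge 1 #(B x) with hB | hB
    · have hball : ∀ y ∈ B x, 3 * m ≤ #((A x).filter fun w => G.dist y w ≤ 3 * m) := by
        intro y hy
        obtain ⟨z, hz, hzy⟩ := exists_mem_ne hB y
        obtain ⟨hyQ, hyx⟩ := mem_filter.mp hy
        obtain ⟨hzQ, hzx⟩ := mem_filter.mp hz
        have := hQ y hyQ z hzQ hzy.symm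
        exact (lt_card_filter_dist_le hG (A x) (hconn x hx) (y := y) (z := z) (by simp [A, hyx])
          (by simp [A, hzx]) (3 * m) (by omega)).le
      have hdisj : (B x : Set V).PairwiseDisjoint
          fun y => (A x).filter fun w => G.dist y w ≤ 3 * m := by
        intro y hy z hz hyz
        refine disjoint_left.mpr fun w h1 h2 => ?_
        have h3 := (mem_filter.mp h1).2
        have h4 := (mem_filter.mp h2).2
        have h5 := hQ y (mem_filter.mp hy).1 z (mem_filter.mp hz).1 hyz
        have h6 : G.dist y z ≤ G.dist y w + G.dist w z := hG.dist_triangle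
        rw [SimpleGraph.dist_comm (u := w)] at h6
        omega
      have h1 : #(B x) * (3 * m) ≤ #(A x) := by
        refine le_trans ?_ (card_le_card (biUnion_subset.mpr fun y (_ : y ∈ B x) =>
          filter_subset (fun w => G.dist y w ≤ 3 * m) (A x)))
        rw [card_biUnion hdisj, ← smul_eq_mul]
        exact card_nsmul_le_sum _ _ _ hball
      nlinarith
    · obtain ⟨z, hz, hzx⟩ := exists_mem_ne (by omega : 1 < #P) x
      have h1 := hP x hx z hz hzx.symm
      have h2 := lt_card_filter_dist_le hG (univ : Finset V)
        (by rw [coe_univ]; exact (SimpleGraph.induceUnivIso G).connected_iff.mpr hG |>.preconnected)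
        (mem_univ x) (mem_univ z) (4 * m) (by omega)
      have h3 : (univ.filter fun w => G.dist x w ≤ 4 * m) ⊆ A x := by
        intro w hw
        have hw := (mem_filter.mp hw).2
        refine mem_filter.mpr ⟨mem_univ _, ?_⟩
        by_contra hne
        have h4 := hP _ (hfP w) x hx hne
        have h5 := hfmin w x hx
        have h6 : G.dist (f w) x ≤ G.dist (f w) w + G.dist w x := hG.dist_triangle
        rw [SimpleGraph.dist_comm (u := f w) (v := w)] at h6
        rw [SimpleGraph.dist_comm (u := x)] at hw
        omega
      have := card_le_card h3
      nlinarith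
  rw [hAcard, hBcard, card_eq_sum_ones, ← sum_add_distrib, mul_sum]
  exact sum_le_sum hcell

/-! ### The cops' strategy -/

/-- The position after moving from `x` one step towards `y` in `T`. -/
noncomputable def stepTowards (hT : T.Connected) (x y : V) : V :=
  open Classical in if h : x = y then x else (exists_adj_dist_succ hT h).choose

lemma stepTowards_eq_or_adj (hT : T.Connected) (x y : V) :
    stepTowards hT x y = x ∨ T.Adj x (stepTowards hT x y) := by
  unfold stepTowards
  split_ifs with h
  · exact .inl rfl
  · exact .inr (exists_adj_dist_succ hT h).choose_spec.1

lemma adj_stepTowards (hT : T.Connected) {x y : V} (h : x ≠ y) :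
    T.Adj x (stepTowards hT x y) := by
  rw [stepTowards, dif_neg h]
  exact (exists_adj_dist_succ hT h).choose_spec.1

lemma dist_stepTowards (hT : T.Connected) {x y : V} (h : x ≠ y) :
    T.dist (stepTowards hT x y) y + 1 = T.dist x y := by
  rw [stepTowards, dif_neg h]
  exact (exists_adj_dist_succ hT h).choose_spec.2

/-- The position of a cop that starts at `d` and always moves towards the robber. -/
noncomputable def chase (hT : T.Connected) (d : V) : List V → V
  | [] => d
  | r :: h => stepTowards hT (chase hT d h) r

/-- The strategy in which the cops in `S` never move and the cops that start in `D` always move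
towards the robber along the spanning tree `T`. -/
noncomputable def guardAndChase (hT : T.Connected) (hTG : T ≤ G) {k : ℕ} (S D : Finset V)
    (e : Fin k ≃ S ⊕ D) : CopStrategy G k where
  pos h i := Sum.elim (fun s : S => (s : V)) (fun d : D => chase hT d h) (e i)
  legal h r i := by
    rcases e i with s | d
    · exact .inl rfl
    · exact (stepTowards_eq_or_adj hT _ r).imp id fun h => hTG h

/-- While the robber is free, each chaser gains one step per round away from its start `d` and stays
between `d` and the robber. After round `r` the robber would be farther than `r` from every `d`. -/
lemma exists_capturedInRound (hT : T.IsTree) (hTG : T ≤ G) {k r : ℕ} (S D : Finset V)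
    (e : Fin k ≃ S ⊕ D) (hS : ∀ v w, G.Adj v w → ¬ T.Adj v w → v ∈ S ∨ w ∈ S)
    (hD : ∀ v, ∃ d ∈ D, T.dist d v ≤ r) (ρ : RobberPlay G) :
    ∃ t ≤ r, CapturedInRound (guardAndChase hT.connected hTG S D e) ρ t := by
  by_contra! hcon
  have hG := hT.connected
  have hguard : ∀ t ≤ r, ρ.pos t ∉ S := by
    intro t ht hmem
    refine hcon t ht ?_
    cases t with
    | zero => exact ⟨e.symm (.inl ⟨_, hmem⟩), by simp [guardAndChase]⟩
    | succ t => exact ⟨e.symm (.inl ⟨_, hmem⟩), .inr (by simp [guardAndChase])⟩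
  have hinv : ∀ d ∈ D, ∀ t ≤ r, T.dist d (chase hG d (history ρ.pos t)) = t ∧
      t + T.dist (chase hG d (history ρ.pos t)) (ρ.pos t) = T.dist d (ρ.pos t) ∧
      chase hG d (history ρ.pos t) ≠ ρ.pos t := by
    intro d hd t
    induction t with
    | zero =>
      intro ht
      refine ⟨by simp [history, chase], by simp [history, chase], fun h => hcon 0 ht ?_⟩
      exact ⟨e.symm (.inr ⟨d, hd⟩), by simpa [guardAndChase, history] using h⟩
    | succ t ih =>
      intro ht
      obtain ⟨h1, h2, h3⟩ := ih (by omega)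
      have hpos : ∀ v, v = ρ.pos t ∨ v = ρ.pos (t + 1) →
          chase hG d (history ρ.pos (t + 1)) ≠ v := by
        rintro v hv rfl
        refine hcon (t + 1) ht ⟨e.symm (.inr ⟨d, hd⟩), ?_⟩
        simpa [guardAndChase] using hv
      have hstep : chase hG d (history ρ.pos (t + 1)) =
        stepTowards hG (chase hG d (history ρ.pos t)) (ρ.pos t) := rfl
      rw [hstep] at hpos ⊢
      set x := chase hG d (history ρ.pos t)
      have h4 := dist_stepTowards hG h3
      have h5 := dist_le_succ_of_adj hG d (adj_stepTowards hG h3)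
      set z := stepTowards hG x (ρ.pos t)
      have h6 : T.dist d (ρ.pos t) ≤ T.dist d z + T.dist z (ρ.pos t) := hG.dist_triangle
      have hz : T.dist d z = t + 1 := by omega
      refine ⟨hz, ?_, hpos _ (.inr rfl)⟩
      rcases ρ.legal t with h | h
      · rw [h]; omega
      -- A move off the tree would start or end on a guard.
      · have hadj : T.Adj (ρ.pos t) (ρ.pos (t + 1)) := by
          by_contra hn
          exact (hS _ _ h hn).elim (hguard t (by omega)) (hguard (t + 1) ht)
        have := between_of_adj hT (c := d) (by omega) (hpos _ (.inl rfl)).symm hadj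
        omega
  obtain ⟨d, hd, hdr⟩ := hD (ρ.pos r)
  obtain ⟨-, h2, h3⟩ := hinv d hd r le_rfl
  have := hG.pos_dist_of_ne h3
  omega

lemma throttlingNumber_le (hT : T.IsTree) (hTG : T ≤ G) {r : ℕ} (S D : Finset V)
    (hS : ∀ v w, G.Adj v w → ¬ T.Adj v w → v ∈ S ∨ w ∈ S)
    (hD : ∀ v, ∃ d ∈ D, T.dist d v ≤ r) :
    throttlingNumber G ≤ ((#S + #D + r : ℕ) : ℕ∞) := by
  let e : Fin (#S + #D) ≃ S ⊕ D := (Fintype.equivFinOfCardEq (by simp)).symm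
  obtain ⟨v⟩ := hT.connected.nonempty
  obtain ⟨d, hd, -⟩ := hD v
  have hpos : 1 ≤ #S + #D := by have := card_pos.mpr ⟨d, hd⟩; omega
  have hcapt : captureTime G (#S + #D) ≤ (r : ℕ∞) := by
    refine iInf_le_of_le (guardAndChase hT.connected hTG S D e) (iSup_le fun ρ => ?_)
    obtain ⟨t, htr, ht⟩ := exists_capturedInRound hT hTG S D e hS hD ρ
    exact (iInf₂_le t ht).trans (by exact_mod_cast htr)
  refine (iInf₂_le (#S + #D) hpos).trans ?_
  rw [Nat.cast_add (#S + #D)]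
  exact add_le_add le_rfl hcapt

/-! ### Fundamental cycles -/

/-- Closing `e` by a tree path gives a cycle whose only non-tree edge is `e`, so `e` can be
recovered from it. -/
lemma exists_fundamental_cycle (hT : T.Connected) (hTG : T ≤ G) {e : Sym2 V}
    (he : e ∈ G.edgeSet \ T.edgeSet) :
    ∃ H ∈ {H : G.Subgraph | ∃ (v : V) (p : G.Walk v v), p.IsCycle ∧ p.toSubgraph = H},
      ∀ e' ∈ G.edgeSet \ T.edgeSet, e' ∈ H.edgeSet ↔ e' = e := by
  induction e using Sym2.ind with
  | _ u v =>
    have huv : G.Adj u v := he.1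
    have hnT := he.2
    obtain ⟨p, hp, -⟩ := hT.exists_path_of_dist v u
    have hedges : ∀ e' ∈ (p.mapLe hTG).edges, e' ∈ T.edgeSet := fun e' h => by
      rw [SimpleGraph.Walk.edges_mapLe_eq_edges] at h
      exact p.edges_subset_edgeSet h
    refine ⟨_, ⟨u, SimpleGraph.Walk.cons huv (p.mapLe hTG), ?_, rfl⟩, fun e' he' => ?_⟩
    · rw [SimpleGraph.Walk.cons_isCycle_iff]
      exact ⟨(SimpleGraph.Walk.isPath_mapLe hTG).mpr hp, fun h => hnT (hedges _ h)⟩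
    · rw [SimpleGraph.Walk.mem_edges_toSubgraph, SimpleGraph.Walk.edges_cons, List.mem_cons]
      exact ⟨fun h => h.resolve_right fun h => he'.2 (hedges _ h), .inl⟩

lemma exists_guards [Finite V] (hT : T.Connected) (hTG : T ≤ G) {k : ℕ}
    (hk : numCycles G ≤ (k : ℕ∞)) :
    ∃ S : Finset V, #S ≤ k ∧ ∀ v w, G.Adj v w → ¬ T.Adj v w → v ∈ S ∨ w ∈ S := by
  classical
  have hle : (G.edgeSet \ T.edgeSet).encard ≤ numCycles G := by
    choose! H hH hHe using fun e he => exists_fundamental_cycle (e := e) hT hTG he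
    refine Set.encard_le_encard_of_injOn (f := H) (fun e he => hH e he) fun a ha b hb hab => ?_
    exact (hHe b hb a ha).mp (hab ▸ (hHe a ha a ha).mpr rfl)
  have hfin : (G.edgeSet \ T.edgeSet).Finite := Set.toFinite _
  refine ⟨hfin.toFinset.image fun e => e.out.1, ?_, fun v w hvw hn => ?_⟩
  · refine card_image_le.trans ?_
    have := hle.trans hk
    rw [hfin.encard_eq_coe_toFinset_card] at this
    exact_mod_cast this
  · have hmem : s(v, w) ∈ hfin.toFinset := by
      rw [Set.Finite.mem_toFinset]
      exact ⟨hvw, hn⟩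
    have hS := mem_image_of_mem (fun e : Sym2 V => e.out.1) hmem
    rcases Sym2.mem_iff.mp (Sym2.out_fst_mem s(v, w)) with h | h
    · exact .inl (h ▸ hS)
    · exact .inr (h ▸ hS)

/-! ### The bound -/

lemma exists_cover_card_add_le [Fintype V] (hT : T.IsTree) :
    ∃ (D : Finset V) (r : ℕ), (∀ v, ∃ d ∈ D, T.dist d v ≤ r) ∧
      ((#D + r : ℕ) : ℝ) ≤ Real.sqrt 14 / 2 * Real.sqrt (Fintype.card V) + 5 := by
  set n := Fintype.card V
  set c := Real.sqrt 14 / 2 * Real.sqrt n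
  have hc0 : 0 ≤ c := by positivity
  have hc2 : c ^ 2 = 7 / 2 * n := by
    rw [mul_pow, div_pow, Real.sq_sqrt (by norm_num), Real.sq_sqrt (by positivity)]
    ring
  -- If both radii fail, `#P + #Q > 2c + 10 - 7m > c + 3`, so `n ≥ 2m(#P + #Q) > 2c²/7 = n`.
  set m := ⌈c / 7⌉₊
  have hm1 : c / 7 ≤ m := Nat.le_ceil _
  have hm2 : (m : ℝ) < c / 7 + 1 := Nat.ceil_lt_add_one (by positivity)
  obtain ⟨D, P, hDP, hD, hP⟩ := exists_cover_packing hT (4 * m)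
  obtain ⟨E, Q, hEQ, hE, hQ⟩ := exists_cover_packing hT (3 * m)
  have hDP' : (#D : ℝ) ≤ #P := by exact_mod_cast hDP
  have hEQ' : (#E : ℝ) ≤ #Q := by exact_mod_cast hEQ
  by_contra! hcon
  have h1 := hcon D (4 * m) hD
  have h2 := hcon E (3 * m) hE
  push_cast at h1 h2
  -- Otherwise `#D + 4m ≤ 1 + 4m < 4c/7 + 5`, and radius `4m` already succeeds.
  have hP2 : 2 ≤ #P := by
    by_contra! h
    have : (#P : ℝ) ≤ 1 := by exact_mod_cast Nat.lt_succ_iff.mp h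
    linarith
  have h3 := card_add_card_le_of_packings hT.connected m P Q hP hQ hP2
  have h4 : 2 * (m : ℝ) * (#P + #Q) ≤ n := by exact_mod_cast h3
  have hn : (0 : ℝ) < n := by
    have := hT.connected.nonempty
    exact_mod_cast Fintype.card_pos
  have hc : 0 < c := by nlinarith
  have h5 : c + 3 < (#P : ℝ) + #Q := by linarith
  nlinarith [mul_le_mul hm1 h5.le (by positivity) (by positivity)]

lemma exists_throttlingNumber_eq [Fintype V] (hG : G.Connected) {k : ℕ}
    (hk : numCycles G ≤ (k : ℕ∞)) :
    ∃ m : ℕ, throttlingNumber G = (m : ℕ∞) ∧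
      (m : ℝ) ≤ (Real.sqrt 14 / 2 + (k + 5) / Real.sqrt (Fintype.card V)) *
        Real.sqrt (Fintype.card V) := by
  obtain ⟨T, hTG, hT⟩ := hG.exists_isTree_le
  obtain ⟨S, hSk, hS⟩ := exists_guards hT.connected hTG hk
  obtain ⟨D, r, hD, hDr⟩ := exists_cover_card_add_le hT
  have hle := throttlingNumber_le hT hTG S D hS hD
  obtain ⟨m, hm⟩ := ENat.ne_top_iff_exists.mp (ne_top_of_le_ne_top (ENat.natCast_ne_top _) hle)
  refine ⟨m, hm.symm, ?_⟩
  rw [← hm] at hle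
  have h1 : (m : ℝ) ≤ #S + (#D + r : ℕ) := by
    rw [← Nat.cast_add, ← add_assoc]
    exact_mod_cast hle
  have h2 : (#S : ℝ) ≤ k := by exact_mod_cast hSk
  have hn : (0 : ℝ) < Real.sqrt (Fintype.card V) := by
    have := hG.nonempty
    exact Real.sqrt_pos.mpr (by exact_mod_cast Fintype.card_pos)
  rw [add_mul, div_mul_cancel₀ _ hn.ne']
  linarith

lemma tendsto_add_five_div_sqrt {k : ℕ → ℕ}
    (hk : (fun n : ℕ => (k n : ℝ)) =o[Filter.atTop] fun n : ℕ => Real.sqrt (n : ℝ)) :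
    Filter.Tendsto (fun n : ℕ => ((k n : ℝ) + 5) / Real.sqrt (n : ℝ)) Filter.atTop (nhds 0) := by
  have h5 : Filter.Tendsto (fun n : ℕ => 5 / Real.sqrt (n : ℝ)) Filter.atTop (nhds 0) :=
    (Real.tendsto_sqrt_atTop.comp tendsto_natCast_atTop_atTop).const_div_atTop 5
  simpa [add_div] using hk.tendsto_div_nhds_zero.add h5

end CopsRobber

theorem mainTheorem10 :
    (∀ k : ℕ → ℕ,
      Asymptotics.IsLittleO Filter.atTop (fun n : ℕ => (k n : ℝ)) (fun n : ℕ => Real.sqrt (n : ℝ)) →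
      ∃ δ : ℕ → ℝ, Filter.Tendsto δ Filter.atTop (nhds 0) ∧
        ∀ (V : Type*) [Fintype V] (G : SimpleGraph V), G.Connected →
          CopsRobber.numCycles G ≤ (k (Fintype.card V) : ℕ∞) →
          ∃ m : ℕ, CopsRobber.throttlingNumber G = (m : ℕ∞) ∧
            (m : ℝ) ≤ (Real.sqrt 14 / 2 + δ (Fintype.card V)) * Real.sqrt (Fintype.card V : ℝ)) ∧
    (∃ δ : ℕ → ℝ, Filter.Tendsto δ Filter.atTop (nhds 0) ∧
      ∀ (V : Type*) [Fintype V] (G : SimpleGraph V), G.Connected →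
        CopsRobber.numCycles G = 1 →
        ∃ m : ℕ, CopsRobber.throttlingNumber G = (m : ℕ∞) ∧
          (m : ℝ) ≤ (Real.sqrt 14 / 2 + δ (Fintype.card V)) * Real.sqrt (Fintype.card V : ℝ)) := by
  refine ⟨fun k hk => ⟨_, CopsRobber.tendsto_add_five_div_sqrt hk, fun V _ G hG hc =>
    CopsRobber.exists_throttlingNumber_eq hG hc⟩, ?_⟩
  have h1 : Asymptotics.IsLittleO Filter.atTop (fun n : ℕ => (((fun _ => 1) : ℕ → ℕ) n : ℝ))
      (fun n : ℕ => Real.sqrt (n : ℝ)) :=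
    Asymptotics.isLittleO_const_left.mpr <| .inr <|
      tendsto_norm_atTop_atTop.comp
        (Real.tendsto_sqrt_atTop.comp tendsto_natCast_atTop_atTop)
  exact ⟨_, CopsRobber.tendsto_add_five_div_sqrt h1, fun V _ G hG hc =>
    CopsRobber.exists_throttlingNumber_eq hG (by simp [hc])⟩
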